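/- A ternary code of length $n$ is a vector subspace $C$ of $\mathbb{F}_3^n$. Its dual is $C^\perp=\{x\in\mathbb{F}_3^n \mid x\cdot y=0 \text{ for all } y\in C\}$, where $x\cdot y$ is the standard inner product, and $C$ is called LCD (linear complementary dual) if $C\cap C^\perp=\{\mathbf 0\}$. An $[n,k]$ code is a code of length $n$ and dimension $k$; it is an $[n,k,d]$ code if moreover the minimum number of nonzero coordinates of a nonzero codeword is $d$. The automorphism group $\mathrm{Aut}(C)$ is the group of all $n\times n$ monomial matrices $P$ over $\mathbb{F}_3$ (exactly one nonzero entry in each row and each column) such that $C=C\cdot P=\{xP\mid x\in C\}$. Every ternary LCD code $C$ of length $n\ge 1$ satisfies $|\mathrm{Aut}(C)|\ge 2$. The smallest length $n$ for which there is a ternary LCD $[n,k]$ code $C$, for some $k$ with $1\le k\le n-1$, such that $|\mathrm{Aut}(C)|=2$ is $n=8$. Moreover, the code $C_8$ with generator matrix $$\begin{pmatrix}1&0&0&0&2&0&0&1\\0&1&0&0&2&2&1&2\\0&0&1&0&1&1&0&0\\0&0&0&1&1&0&1&2\end{pmatrix}$$ is a ternary LCD $[8,4,3]$ code with $|\mathrm{Aut}(C_8)|=2$.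 -/

import Mathlib

namespace LCDCode

open scoped Matrix

/-- A linear code of length `n` over `F`: a vector subspace of `F ^ n`. -/
abbrev Code (F : Type*) [Field F] (n : ℕ) : Type _ := Submodule F (Fin n → F)

variable {F : Type*} [Field F] {n : ℕ}

/-- The dual code, with respect to the standard inner product. -/
def dual (C : Code F n) : Code F n where
  carrier := {x | ∀ y ∈ C, x ⬝ᵥ y = 0}
  zero_mem' := fun y _ => zero_dotProduct y
  add_mem' := fun {a b} ha hb y hy => by rw [add_dotProduct, ha y hy, hb y hy, add_zero]
  smul_mem' := fun c x hx y hy => by rw [smul_dotProduct, hx y hy, smul_zero]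

/-- `C` is linear complementary dual: it meets its dual only in the zero vector. -/
def IsLCD (C : Code F n) : Prop := C ⊓ dual C = ⊥

/-- `d` is the minimum weight of `C`, the smallest weight of a nonzero codeword. -/
def HasMinWeight [DecidableEq F] (C : Code F n) (d : ℕ) : Prop :=
  IsLeast {w : ℕ | ∃ x ∈ C, x ≠ 0 ∧ hammingNorm x = w} d

/-- The code generated by the rows of a matrix. -/
def rowCode {k : ℕ} (G : Matrix (Fin k) (Fin n) F) : Code F n :=
  Submodule.span F (Set.range fun i => G i)

/-- Monomial matrices: exactly one nonzero entry in each row and in each column. -/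
def IsMonomial (P : Matrix (Fin n) (Fin n) F) : Prop :=
  (∀ i, ∃! j, P i j ≠ 0) ∧ (∀ j, ∃! i, P i j ≠ 0)

/-- The code `C · P = {x P | x ∈ C}`. -/
def mulRight (C : Code F n) (P : Matrix (Fin n) (Fin n) F) : Code F n :=
  C.map P.vecMulLinear

theorem IsMonomial.transpose {P : Matrix (Fin n) (Fin n) F} (hP : IsMonomial P) :
    IsMonomial Pᵀ := ⟨hP.2, hP.1⟩

theorem isMonomial_one : IsMonomial (1 : Matrix (Fin n) (Fin n) F) := by
  constructor <;> intro i <;> refine ⟨i, by simp, fun j hj => ?_⟩ <;> by_contra h <;>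
    simp [h, Ne.symm h] at hj

theorem IsMonomial.row_mul {P Q : Matrix (Fin n) (Fin n) F} (hP : IsMonomial P)
    (hQ : IsMonomial Q) (i : Fin n) : ∃! j, (P * Q) i j ≠ 0 := by
  obtain ⟨k, hk, hku⟩ := hP.1 i
  have key : ∀ j, (P * Q) i j = P i k * Q k j := by
    intro j
    rw [Matrix.mul_apply]
    refine Finset.sum_eq_single k (fun l _ hl => ?_) (fun h => absurd (Finset.mem_univ _) h)
    have h0 : P i l = 0 := by
      by_contra h
      exact hl (hku l h)
    rw [h0, zero_mul]
  obtain ⟨j, hj, hju⟩ := hQ.1 k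
  refine ⟨j, ?_, fun l hl => hju l ?_⟩
  · simp only [key]
    exact mul_ne_zero hk hj
  · simp only [key] at hl
    exact right_ne_zero_of_mul hl

theorem IsMonomial.mul {P Q : Matrix (Fin n) (Fin n) F} (hP : IsMonomial P)
    (hQ : IsMonomial Q) : IsMonomial (P * Q) := by
  refine ⟨hP.row_mul hQ, fun j => ?_⟩
  have h := hQ.transpose.row_mul hP.transpose j
  rw [← Matrix.transpose_mul] at h
  exact h

theorem IsMonomial.row_inv {P Q : Matrix (Fin n) (Fin n) F} (hP : IsMonomial P)
    (hPQ : P * Q = 1) (r : Fin n) : ∃! j, Q r j ≠ 0 := by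
  obtain ⟨i, hi, -⟩ := hP.2 r
  obtain ⟨k, -, hku⟩ := hP.1 i
  have key : ∀ j, (1 : Matrix (Fin n) (Fin n) F) i j = P i r * Q r j := by
    intro j
    rw [← hPQ, Matrix.mul_apply]
    refine Finset.sum_eq_single r (fun l _ hl => ?_) (fun h => absurd (Finset.mem_univ _) h)
    have h0 : P i l = 0 := by
      by_contra h
      exact hl ((hku l h).trans (hku r hi).symm)
    rw [h0, zero_mul]
  refine ⟨i, fun h => ?_, fun j hj => ?_⟩
  · have h1 := key i
    rw [h, mul_zero, Matrix.one_apply_eq] at h1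
    exact one_ne_zero h1
  · by_contra hne
    have h1 := key j
    rw [Matrix.one_apply_ne (Ne.symm hne)] at h1
    exact mul_ne_zero hi hj h1.symm

theorem IsMonomial.inv {P Q : Matrix (Fin n) (Fin n) F} (hP : IsMonomial P)
    (hPQ : P * Q = 1) (hQP : Q * P = 1) : IsMonomial Q := by
  refine ⟨hP.row_inv hPQ, fun j => ?_⟩
  have h : Pᵀ * Qᵀ = 1 := by rw [← Matrix.transpose_mul, hQP, Matrix.transpose_one]
  exact hP.transpose.row_inv h j

theorem mulRight_one (C : Code F n) : mulRight C 1 = C := by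
  ext x
  simp [mulRight]

theorem mulRight_mul (C : Code F n) (P Q : Matrix (Fin n) (Fin n) F) :
    mulRight C (P * Q) = mulRight (mulRight C P) Q := by
  ext x
  simp [mulRight]

/-- The automorphism group of `C`: all monomial matrices `P` with `C = C · P`, as a subgroup of
the general linear group. -/
def Aut (C : Code F n) : Subgroup (GL (Fin n) F) where
  carrier := {P | IsMonomial (P : Matrix (Fin n) (Fin n) F) ∧
    C = mulRight C (P : Matrix (Fin n) (Fin n) F)}
  one_mem' := ⟨isMonomial_one, (mulRight_one C).symm⟩
  mul_mem' := fun {P Q} hP hQ => by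
    refine ⟨?_, ?_⟩
    · rw [Units.val_mul]
      exact hP.1.mul hQ.1
    · rw [Units.val_mul, mulRight_mul, ← hP.2, ← hQ.2]
  inv_mem' := fun {P} hP => by
    refine ⟨hP.1.inv P.mul_inv P.inv_mul, ?_⟩
    conv_rhs => rw [hP.2]
    rw [← mulRight_mul, P.mul_inv, mulRight_one]

/-- Every monomial matrix is invertible, so `Aut C` contains all monomial `P` with `C = C · P`. -/
theorem IsMonomial.isUnit {P : Matrix (Fin n) (Fin n) F} (hP : IsMonomial P) : IsUnit P := by
  choose s hs hsu using hP.1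
  choose t ht htu using hP.2
  refine isUnit_iff_exists_inv.2 ⟨Matrix.of fun j i => if s i = j then (P i j)⁻¹ else 0, ?_⟩
  ext i k
  rw [Matrix.mul_apply, Finset.sum_eq_single (s i)]
  · by_cases h : i = k
    · subst h
      simp [mul_inv_cancel₀ (hs i)]
    · have h2 : s k ≠ s i := fun h2 => h (by
        rw [htu (s i) i (hs i), ← h2, ← htu (s k) k (hs k)])
      simp [h2, h]
  · intro l _ hl
    have h0 : P i l = 0 := by
      by_contra h
      exact hl (hsu i l h)
    rw [h0, zero_mul]
  · exact fun h => absurd (Finset.mem_univ _) h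

/-- The generator matrix `(I₄ M₈)` of the ternary code `C₈`. -/
def G8 : Matrix (Fin 4) (Fin 8) (ZMod 3) :=
  !![1, 0, 0, 0, 2, 0, 0, 1;
     0, 1, 0, 0, 2, 2, 1, 2;
     0, 0, 1, 0, 1, 1, 0, 0;
     0, 0, 0, 1, 1, 0, 1, 2]

/-- The ternary code `C₈`. -/
def C8 : Code (ZMod 3) 8 := rowCode G8

end LCDCode

/-! Since -1 is always an automorphism, order 2 means that 1 and -1 are the only ones. Lower bound:
monomial matrices over the field with three elements are orthogonal, so a code and its dual have the
same group, and for length at most 7 one of the two has dimension k ≤ 3. A zero coordinate or two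
proportional coordinates give an explicit extra automorphism. Otherwise the coordinate functionals
form an n-set of points in a projective space of dimension k - 1. As GL_k has more than twice as
many elements as there are n-sets, pigeonhole yields a linear map other than 1 and -1 stabilising
the set (`exists_stabilizing_unit`), which induces an automorphism (`card_Aut_ne_two_of_units`). For
`C8`: automorphisms commute with the orthogonal projection E onto the code. Support counts of E
force the permutation to be trivial, and connectedness of its support graph makes all signs equal.
-/

namespace LCDCode

open scoped Matrix LinearAlgebra.Projectivization

/-! ### Monomial matrices and duality over a field -/

section General

variable {F : Type*} [Field F] {n : ℕ}

/-- The monomial matrix with entry `ε j` in position `(σ j, j)`, so that right multiplication by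
it sends `x` to the vector with coordinates `ε j * x (σ j)`. -/
def signedPerm (σ : Fin n → Fin n) (ε : Fin n → F) : Matrix (Fin n) (Fin n) F :=
  Matrix.of fun i j => if i = σ j then ε j else 0

theorem signedPerm_apply (σ : Fin n → Fin n) (ε : Fin n → F) (i j : Fin n) :
    signedPerm σ ε i j = if i = σ j then ε j else 0 := rfl

theorem vecMul_signedPerm (σ : Fin n → Fin n) (ε : Fin n → F) (x : Fin n → F) (j : Fin n) :
    (x ᵥ* signedPerm σ ε) j = ε j * x (σ j) := by
  simp [Matrix.vecMul, dotProduct, signedPerm_apply, mul_comm]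

theorem mul_signedPerm_apply (A : Matrix (Fin n) (Fin n) F) (σ : Fin n → Fin n) (ε : Fin n → F)
    (i j : Fin n) : (A * signedPerm σ ε) i j = A i (σ j) * ε j := by
  simp [Matrix.mul_apply, signedPerm_apply]

theorem signedPerm_mul_apply {σ : Fin n → Fin n} (hσ : σ.Injective) (ε : Fin n → F)
    (A : Matrix (Fin n) (Fin n) F) (i j : Fin n) :
    (signedPerm σ ε * A) (σ i) j = ε i * A i j := by
  rw [Matrix.mul_apply, Finset.sum_eq_single i]
  · simp [signedPerm_apply]
  · intro k _ hk
    simp [signedPerm_apply, hσ.ne hk.symm]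
  · simp

theorem isMonomial_signedPerm {σ : Fin n → Fin n} (hσ : σ.Injective) {ε : Fin n → F}
    (hε : ∀ j, ε j ≠ 0) : IsMonomial (signedPerm σ ε) := by
  constructor
  · intro i
    obtain ⟨j, rfl⟩ := (Finite.injective_iff_surjective.1 hσ) i
    refine ⟨j, by simp [signedPerm_apply, hε], fun k hk => ?_⟩
    by_contra hne
    exact hk (if_neg fun h => hne (hσ h).symm)
  · intro j
    refine ⟨σ j, by simp [signedPerm_apply, hε], fun k hk => ?_⟩
    by_contra hne
    exact hk (if_neg hne)

theorem IsMonomial.exists_eq_signedPerm {P : Matrix (Fin n) (Fin n) F} (hP : IsMonomial P) :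
    ∃ (σ : Fin n → Fin n) (ε : Fin n → F), σ.Injective ∧ (∀ j, ε j ≠ 0) ∧ P = signedPerm σ ε := by
  choose σ hσ hσu using hP.2
  refine ⟨σ, fun j => P (σ j) j, fun i j hij => ?_, hσ, ?_⟩
  · refine (hP.1 (σ i)).unique (hσ i) ?_
    rw [hij]
    exact hσ j
  · ext i j
    rw [signedPerm_apply]
    split_ifs with h
    · rw [h]
    · by_contra h0
      exact h (hσu j i h0)

/-- A monomial matrix that maps `C` into itself maps `C` onto itself. -/
theorem eq_mulRight_of_vecMul_mem {C : Code F n} {P : Matrix (Fin n) (Fin n) F}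
    (hP : IsMonomial P) (h : ∀ x ∈ C, x ᵥ* P ∈ C) : C = mulRight C P := by
  refine (Submodule.eq_of_le_of_finrank_eq ?_ ?_).symm
  · rintro _ ⟨x, hx, rfl⟩
    exact h x hx
  · exact (Submodule.equivMapOfInjective P.vecMulLinear
      (Matrix.vecMul_injective_of_isUnit hP.isUnit) C).finrank_eq.symm

theorem vecMul_mem_of_eq_mulRight {C : Code F n} {P : Matrix (Fin n) (Fin n) F}
    (h : C = mulRight C P) {x : Fin n → F} (hx : x ∈ C) : x ᵥ* P ∈ C := by
  rw [h]
  exact ⟨x, hx, rfl⟩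

theorem exists_mem_Aut {C : Code F n} {P : Matrix (Fin n) (Fin n) F}
    (hP : IsMonomial P) (h : ∀ x ∈ C, x ᵥ* P ∈ C) : ∃ Q ∈ Aut C, (Q : Matrix (Fin n) (Fin n) F) = P :=
  ⟨hP.isUnit.unit, ⟨hP, eq_mulRight_of_vecMul_mem hP h⟩, rfl⟩

theorem neg_one_mem_Aut (C : Code F n) : -1 ∈ Aut C := by
  have hm : IsMonomial (-1 : Matrix (Fin n) (Fin n) F) := by
    have h := isMonomial_one (F := F) (n := n)
    simpa [IsMonomial] using h
  refine ⟨by simpa using hm, ?_⟩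
  refine eq_mulRight_of_vecMul_mem (by simpa using hm) fun x hx => ?_
  simpa [Matrix.vecMul_neg] using hx

theorem dual_eq_orthogonal (C : Code F n) :
    dual C = (Matrix.toBilin' (1 : Matrix (Fin n) (Fin n) F)).orthogonal C := by
  ext x
  rw [LinearMap.BilinForm.mem_orthogonal_iff]
  refine forall₂_congr fun y _ => ?_
  rw [Matrix.toBilin'_apply', Matrix.one_mulVec, dotProduct_comm]

theorem nondegenerate_toBilin'_one :
    (Matrix.toBilin' (1 : Matrix (Fin n) (Fin n) F)).Nondegenerate :=
  LinearMap.BilinForm.nondegenerate_toBilin'_of_det_ne_zero' _ (by simp)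

theorem finrank_dual (C : Code F n) :
    Module.finrank F (dual C) = n - Module.finrank F C := by
  rw [dual_eq_orthogonal, LinearMap.BilinForm.finrank_orthogonal nondegenerate_toBilin'_one]
  simp

theorem dual_dual (C : Code F n) : dual (dual C) = C := by
  rw [dual_eq_orthogonal, dual_eq_orthogonal,
    LinearMap.BilinForm.orthogonal_orthogonal nondegenerate_toBilin'_one]
  intro x y h
  rw [Matrix.toBilin'_apply', Matrix.one_mulVec] at h ⊢
  rw [dotProduct_comm, h]

end General

/-! ### Orthogonality of ternary automorphisms -/

section Ternary

variable {n : ℕ}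

theorem one_ne_neg_one (hn : 1 ≤ n) : (1 : GL (Fin n) (ZMod 3)) ≠ -1 := by
  intro h
  have h1 := congrArg (fun P : GL (Fin n) (ZMod 3) => (P : Matrix (Fin n) (Fin n) (ZMod 3)) ⟨0, hn⟩ ⟨0, hn⟩) h
  simp only [Units.val_one, Units.val_neg, Matrix.neg_apply, Matrix.one_apply_eq] at h1
  exact absurd h1 (by decide)

theorem two_le_card_Aut (C : Code (ZMod 3) n) (hn : 1 ≤ n) : 2 ≤ Nat.card (Aut C) := by
  rw [Nat.succ_le_iff, Finite.one_lt_card_iff_nontrivial]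
  exact ⟨⟨1, one_mem _⟩, ⟨-1, neg_one_mem_Aut C⟩, fun h => one_ne_neg_one hn (congrArg Subtype.val h)⟩

theorem card_Aut_ne_two {C : Code (ZMod 3) n} (hn : 1 ≤ n) {P : GL (Fin n) (ZMod 3)}
    (hP : P ∈ Aut C) (h1 : P ≠ 1) (h2 : P ≠ -1) : Nat.card (Aut C) ≠ 2 := by
  intro h
  obtain ⟨Q, -, hQ⟩ := (Nat.card_eq_two_iff' (1 : Aut C)).1 h
  have e1 := hQ ⟨P, hP⟩ fun e => h1 (congrArg Subtype.val e)
  have e2 := hQ ⟨-1, neg_one_mem_Aut C⟩ fun e => one_ne_neg_one hn (congrArg Subtype.val e).symm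
  exact h2 (congrArg Subtype.val (e1.trans e2.symm))

theorem mul_self_eq_one_of_ne_zero : ∀ {a : ZMod 3}, a ≠ 0 → a * a = 1 := by decide

/-- The only nonzero square in `ZMod 3` is 1, so the columns are orthonormal. -/
theorem IsMonomial.mul_transpose {P : Matrix (Fin n) (Fin n) (ZMod 3)} (hP : IsMonomial P) :
    P * Pᵀ = 1 := by
  rw [mul_eq_one_comm]
  obtain ⟨σ, ε, hσ, hε, rfl⟩ := hP.exists_eq_signedPerm
  ext i j
  rw [mul_signedPerm_apply, Matrix.transpose_apply, signedPerm_apply]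
  by_cases h : i = j
  · subst h
    simp [mul_self_eq_one_of_ne_zero (hε i)]
  · simp [h, hσ.ne (Ne.symm h)]

theorem inv_coe_of_mem_Aut {C : Code (ZMod 3) n} {P : GL (Fin n) (ZMod 3)} (hP : P ∈ Aut C) :
    ((P⁻¹ : GL (Fin n) (ZMod 3)) : Matrix (Fin n) (Fin n) (ZMod 3)) = (P : Matrix (Fin n) (Fin n) (ZMod 3))ᵀ :=
  left_inv_eq_right_inv P.inv_mul hP.1.mul_transpose

theorem vecMul_transpose_mem_of_mem_Aut {C : Code (ZMod 3) n} {P : GL (Fin n) (ZMod 3)}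
    (hP : P ∈ Aut C) {x : Fin n → ZMod 3} (hx : x ∈ C) :
    x ᵥ* (P : Matrix (Fin n) (Fin n) (ZMod 3))ᵀ ∈ C := by
  rw [← inv_coe_of_mem_Aut hP]
  exact vecMul_mem_of_eq_mulRight ((Aut C).inv_mem hP).2 hx

/-- The adjoint of `P` is its inverse, which also preserves `C`. -/
theorem Aut_le_Aut_dual (C : Code (ZMod 3) n) : Aut C ≤ Aut (dual C) := by
  intro P hP
  refine ⟨hP.1, eq_mulRight_of_vecMul_mem hP.1 fun x hx y hy => ?_⟩
  rw [← Matrix.dotProduct_mulVec, ← Matrix.vecMul_transpose]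
  exact hx _ (vecMul_transpose_mem_of_mem_Aut hP hy)

theorem Aut_dual (C : Code (ZMod 3) n) : Aut (dual C) = Aut C := by
  refine le_antisymm ?_ (Aut_le_Aut_dual C)
  have h := Aut_le_Aut_dual (dual C)
  rwa [dual_dual] at h

/-! ### Extra automorphisms in length below 8 -/

theorem card_Aut_ne_two_of_zero_coordinate {C : Code (ZMod 3) n} (hn : 2 ≤ n) (i : Fin n)
    (hi : ∀ x ∈ C, x i = 0) : Nat.card (Aut C) ≠ 2 := by
  have : Nontrivial (Fin n) := Fin.nontrivial_iff_two_le.2 hn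
  obtain ⟨j, hj⟩ := exists_ne i
  -- Flipping the sign of the zero coordinate fixes every codeword; a second coordinate `j` tells
  -- the flip from -1.
  set ε : Fin n → ZMod 3 := Function.update 1 i (-1)
  have hε : ∀ k, ε k ≠ 0 := by
    intro k
    by_cases h : k = i <;> simp [ε, h]
  obtain ⟨P, hP, hPe⟩ := exists_mem_Aut (C := C)
    (isMonomial_signedPerm Function.injective_id hε) fun x hx => by
      convert hx
      ext k
      rw [vecMul_signedPerm]
      by_cases h : k = i
      · simp [h, hi x hx]
      · simp [ε, h]
  refine card_Aut_ne_two (by lia) hP ?_ ?_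
  · rintro rfl
    have h := congrFun₂ hPe i i
    simp [signedPerm_apply, ε] at h
    exact absurd h (by decide)
  · rintro rfl
    have h := congrFun₂ hPe j j
    simp [signedPerm_apply, ε, hj] at h
    exact absurd h (by decide)

theorem card_Aut_ne_two_of_proportional_coordinates {C : Code (ZMod 3) n} {i j : Fin n}
    (hij : i ≠ j) {a : ZMod 3} (ha : a ≠ 0) (h : ∀ x ∈ C, x j = a * x i) :
    Nat.card (Aut C) ≠ 2 := by
  -- Swapping the two coordinates and scaling both by `a` fixes every codeword, because `a * a = 1`.
  set ε : Fin n → ZMod 3 := fun k => if k = i ∨ k = j then a else 1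
  have hε : ∀ k, ε k ≠ 0 := by
    intro k
    by_cases h : k = i ∨ k = j <;> simp [ε, h, ha]
  obtain ⟨P, hP, hPe⟩ := exists_mem_Aut (C := C)
    (isMonomial_signedPerm (Equiv.swap i j).injective hε) fun x hx => by
      convert hx
      ext k
      rw [vecMul_signedPerm]
      by_cases hi : k = i
      · simp [hi, ε, h x hx, ← mul_assoc, mul_self_eq_one_of_ne_zero ha]
      by_cases hj : k = j
      · simp [hj, ε, h x hx]
      · simp [ε, hi, hj, Equiv.swap_apply_of_ne_of_ne hi hj]
  refine card_Aut_ne_two (by lia) hP ?_ ?_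
  all_goals
    rintro rfl
    have h := congrFun₂ hPe i j
    simp [signedPerm_apply, ε, hij, ha.symm] at h

/-- The coordinate functional of a code. -/
def coord {F : Type*} [Field F] (C : Code F n) (i : Fin n) : Module.Dual F C :=
  (LinearMap.proj i).comp C.subtype

/-- A linear automorphism of the dual space of `C` that permutes the coordinate functionals up to
scalars is induced by a monomial automorphism. -/
theorem card_Aut_ne_two_of_units {C : Code (ZMod 3) n} (hn : 1 ≤ n)
    (U : LinearMap.GeneralLinearGroup (ZMod 3) (Module.Dual (ZMod 3) C)) 
    (h1 : ∃ f : Module.Dual (ZMod 3) C, U • f ≠ f)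
    (h2 : ∃ f : Module.Dual (ZMod 3) C, U • f ≠ -f) {σ : Fin n → Fin n} (hσ : σ.Injective) {ε : Fin n → ZMod 3}
    (hε : ∀ j, ε j ≠ 0) (h : ∀ j, U • coord C j = ε j • coord C (σ j)) : Nat.card (Aut C) ≠ 2 := by
  have adj : ∀ x : C, ∃ y : C, (y : Fin n → ZMod 3) = (x : Fin n → ZMod 3) ᵥ* signedPerm σ ε ∧
      ∀ f : Module.Dual (ZMod 3) C, f y = (U • f) x := by
    intro x
    -- By reflexivity, evaluation at `x` after `U` is evaluation at some `y`: this is the adjoint of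
    -- `U` acting on `C`.
    obtain ⟨y, hy⟩ := (Module.evalEquiv (ZMod 3) C).surjective
      ((Module.Dual.eval (ZMod 3) C x).comp U.val)
    have hf : ∀ f : Module.Dual (ZMod 3) C, f y = (U • f) x := fun f => LinearMap.congr_fun hy f
    refine ⟨y, funext fun j => ?_, hf⟩
    rw [vecMul_signedPerm]
    exact (hf (coord C j)).trans (by rw [h]; rfl)
  obtain ⟨P, hP, hPe⟩ := exists_mem_Aut (C := C) (isMonomial_signedPerm hσ hε) fun x hx => by
    obtain ⟨y, hy, -⟩ := adj ⟨x, hx⟩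
    exact hy ▸ y.2
  refine card_Aut_ne_two hn hP ?_ ?_
  · rintro rfl
    obtain ⟨f, hf⟩ := h1
    refine hf (LinearMap.ext fun x => ?_)
    obtain ⟨y, hy, hU⟩ := adj x
    have hyx : y = x := Subtype.ext (by simp [hy, ← hPe])
    rw [← hU, hyx]
  · rintro rfl
    obtain ⟨f, hf⟩ := h2
    refine hf (LinearMap.ext fun x => ?_)
    obtain ⟨y, hy, hU⟩ := adj x
    have hyx : y = -x := Subtype.ext (by simp [hy, ← hPe, Matrix.vecMul_neg])
    rw [← hU, hyx, map_neg, LinearMap.neg_apply]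

theorem card_linearGroup {F V : Type*} [Field F] [Fintype F] [AddCommGroup V] [Module F V]
    {k : ℕ} (hk : Module.finrank F V = k) [FiniteDimensional F V] :
    Nat.card (LinearMap.GeneralLinearGroup F V) =
      ∏ i : Fin k, (Fintype.card F ^ k - Fintype.card F ^ (i : ℕ)) := by
  rw [← Matrix.card_GL_field]
  exact Nat.card_congr (Units.mapEquiv
    (LinearMap.toMatrixAlgEquiv (Module.finBasisOfFinrankEq F V hk)).toMulEquiv).toEquiv

/-- If the general linear group has more than twice as many elements as there are `m`-element sets
of points, then each such set is stabilised by an element other than `1` and `-1`. -/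
theorem exists_stabilizing_unit {V : Type*} [AddCommGroup V] [Module (ZMod 3) V] [Finite V]
    (m : ℕ) (hm : (Nat.card (ℙ (ZMod 3) V)).choose m * 2 <
      Nat.card (LinearMap.GeneralLinearGroup (ZMod 3) V))
    (S : Finset (ℙ (ZMod 3) V)) (hS : S.card = m) :
    ∃ U : LinearMap.GeneralLinearGroup (ZMod 3) V,
      (∃ v : V, U • v ≠ v) ∧ (∃ v : V, U • v ≠ -v) ∧ ∀ p ∈ S, U • p ∈ S := by
  suffices h : ∃ U : LinearMap.GeneralLinearGroup (ZMod 3) V,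
      U ≠ 1 ∧ U ≠ -1 ∧ ∀ p ∈ S, U • p ∈ S by
    obtain ⟨U, h1, h2, hU⟩ := h
    refine ⟨U, ?_, ?_, hU⟩
    · by_contra! h
      exact h1 (Units.ext (LinearMap.ext h))
    · by_contra! h
      exact h2 (Units.ext (LinearMap.ext h))
  classical
  have := Fintype.ofFinite (ℙ (ZMod 3) V)
  have : Finite (LinearMap.GeneralLinearGroup (ZMod 3) V) := by
    refine Nat.finite_of_card_ne_zero (by lia)
  have := Fintype.ofFinite (LinearMap.GeneralLinearGroup (ZMod 3) V)
  let move := fun T : LinearMap.GeneralLinearGroup (ZMod 3) V => S.image (T • ·)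
  -- Three elements with the same image of `S` are needed: one of two quotients may be -1, but not
  -- both.
  obtain ⟨R, -, hR⟩ := Finset.exists_lt_card_fiber_of_mul_lt_card_of_maps_to
    (s := Finset.univ) (t := Finset.powersetCard m Finset.univ) (f := move) (n := 2)
    (fun T _ => by
      rw [Finset.mem_powersetCard_univ, ← hS]
      exact Finset.card_image_of_injective _ (MulAction.injective T))
    (by simpa [Finset.card_powersetCard, ← Nat.card_eq_fintype_card] using hm)
  have stab : ∀ {T U}, move T = R → move U = R → ∀ p ∈ S, (T⁻¹ * U) • p ∈ S := by
    intro T U hT hU p hp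
    have h : U • p ∈ move T := hT.trans hU.symm ▸ Finset.mem_image_of_mem _ hp
    obtain ⟨q, hq, hqp⟩ := Finset.mem_image.1 h
    rw [mul_smul, ← hqp, inv_smul_smul]
    exact hq
  obtain ⟨T, hT, U, hU, W, hW, hTU, hTW, hUW⟩ := Finset.two_lt_card.1 hR
  simp only [Finset.mem_filter, Finset.mem_univ, true_and] at hT hU hW
  by_cases hneg : T⁻¹ * U = -1
  · refine ⟨T⁻¹ * W, fun h => hTW (inv_mul_eq_one.1 h), fun h => hUW ?_, stab hT hW⟩
    exact mul_left_cancel (hneg.trans h.symm)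
  · exact ⟨T⁻¹ * U, fun h => hTU (inv_mul_eq_one.1 h), hneg, stab hT hU⟩

theorem card_Aut_ne_two_of_finrank_le_three {C : Code (ZMod 3) n} (hn : 2 ≤ n)
    (h1 : 1 ≤ Module.finrank (ZMod 3) C) (h3 : Module.finrank (ZMod 3) C ≤ 3) :
    Nat.card (Aut C) ≠ 2 := by
  classical
  by_cases hz : ∃ i, coord C i = 0
  · obtain ⟨i, hi⟩ := hz
    exact card_Aut_ne_two_of_zero_coordinate hn i fun x hx => LinearMap.congr_fun hi ⟨x, hx⟩
  push Not at hz
  let p : Fin n → ℙ (ZMod 3) (Module.Dual (ZMod 3) C) := fun i => .mk _ (coord C i) (hz i)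
  by_cases hp : p.Injective
  swap
  · simp only [Function.Injective, not_forall] at hp
    obtain ⟨i, j, hpij, hij⟩ := hp
    obtain ⟨a, ha⟩ := (Projectivization.mk_eq_mk_iff _ _ _ (hz j) (hz i)).1 hpij.symm
    exact card_Aut_ne_two_of_proportional_coordinates hij a.ne_zero fun x hx =>
      (LinearMap.congr_fun ha ⟨x, hx⟩).symm
  have hdual := Subspace.dual_finrank_eq (K := ZMod 3) (V := C)
  have hfin : Finite (Module.Dual (ZMod 3) C) := Module.finite_of_finite (ZMod 3)
  have hcard := Projectivization.card_of_finrank (ZMod 3) (Module.Dual (ZMod 3) C) hdual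
  have hGL := card_linearGroup hdual
  rw [Nat.card_zmod] at hcard
  rw [ZMod.card] at hGL
  have hlt : (Nat.card (ℙ (ZMod 3) (Module.Dual (ZMod 3) C))).choose n * 2 <
      Nat.card (LinearMap.GeneralLinearGroup (ZMod 3) (Module.Dual (ZMod 3) C)) := by
    rw [hGL, hcard]
    have hle := Nat.card_le_card_of_injective p hp
    rw [Nat.card_fin, hcard] at hle
    generalize Module.finrank (ZMod 3) C = k at h1 h3 hle
    -- For k = 1 there is a single point, against n ≥ 2. For k = 2 there are 4 points and 2 · 6 <
    -- 48; for k = 3 there are 13 points and 2 · 1716 < 11232. The middle binomial coefficient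
    -- covers all n.
    interval_cases k
    · exact absurd (hn.trans hle) (by decide)
    · exact (Nat.mul_le_mul_right 2 (Nat.choose_le_middle n _)).trans_lt (by decide)
    · exact (Nat.mul_le_mul_right 2 (Nat.choose_le_middle n _)).trans_lt (by decide +kernel)
  obtain ⟨U, hU1, hU2, hUS⟩ := exists_stabilizing_unit n hlt (Finset.univ.image p)
    (by rw [Finset.card_image_of_injective _ hp, Finset.card_fin])
  have hσ : ∀ j, ∃ i, U • p j = p i := fun j => by
    obtain ⟨i, -, hi⟩ := Finset.mem_image.1 (hUS _ (Finset.mem_image_of_mem p (Finset.mem_univ j)))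
    exact ⟨i, hi.symm⟩
  choose σ hσ using hσ
  have hε : ∀ j, ∃ a : (ZMod 3)ˣ, a • coord C (σ j) = U • coord C j := fun j => by
    have h := hσ j
    rw [Projectivization.smul_mk] at h
    exact (Projectivization.mk_eq_mk_iff _ _ _ _ _).1 h
  choose ε hε using hε
  refine card_Aut_ne_two_of_units (by lia) U hU1 hU2 (σ := σ) (fun i j hij => ?_)
    (ε := fun j => ε j) (fun j => (ε j).ne_zero) fun j => (hε j).symm
  refine hp (MulAction.injective U ?_)
  exact (hσ i).trans (hij ▸ (hσ j).symm)

theorem card_Aut_ne_two_of_lt_eight {C : Code (ZMod 3) n} (hn : n < 8)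
    (h1 : 1 ≤ Module.finrank (ZMod 3) C) (h2 : Module.finrank (ZMod 3) C < n) :
    Nat.card (Aut C) ≠ 2 := by
  by_cases h3 : Module.finrank (ZMod 3) C ≤ 3
  · exact card_Aut_ne_two_of_finrank_le_three (by lia) h1 h3
  · rw [← Aut_dual]
    have h := finrank_dual C
    exact card_Aut_ne_two_of_finrank_le_three (by lia) (by lia) (by lia)

end Ternary

/-! ### The code of length 8 -/

section C8

/-- The matrix of the orthogonal projection onto `C8`. -/
def projector8 : Matrix (Fin 8) (Fin 8) (ZMod 3) :=
  !![2, 2, 2, 0, 1, 0, 2, 0;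
     2, 0, 2, 2, 2, 2, 2, 0;
     2, 2, 1, 1, 1, 2, 0, 2;
     0, 2, 1, 1, 0, 2, 0, 0;
     1, 2, 1, 0, 1, 2, 2, 2;
     0, 2, 2, 2, 2, 0, 1, 2;
     2, 2, 0, 0, 2, 1, 2, 0;
     0, 0, 2, 0, 2, 2, 0, 0]

theorem projector8_transpose : projector8ᵀ = projector8 := by decide

theorem G8_mul_projector8 : G8 * projector8 = G8 := by decide +kernel

/-- The first four columns of `projector8` express its rows in terms of the rows of `G8`. -/
theorem projector8_eq_mul :
    (Matrix.of fun i (j : Fin 4) => projector8 i (Fin.castLE (by decide) j)) * G8 = projector8 := by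
  decide +kernel

theorem rowCode_eq_range {F : Type*} [Field F] {n k : ℕ} (G : Matrix (Fin k) (Fin n) F) :
    rowCode G = LinearMap.range G.vecMulLinear := (range_vecMulLinear G).symm

theorem mem_rowCode {F : Type*} [Field F] {n k : ℕ} {G : Matrix (Fin k) (Fin n) F}
    {x : Fin n → F} : x ∈ rowCode G ↔ ∃ v, v ᵥ* G = x := by
  rw [rowCode_eq_range]
  rfl

theorem vecMul_G8_injective : Function.Injective fun v : Fin 4 → ZMod 3 => v ᵥ* G8 := by
  have h : G8.submatrix id (Fin.castLE (by decide : 4 ≤ 8)) = 1 := by decide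
  intro v w hvw
  rw [← Matrix.vecMul_one v, ← Matrix.vecMul_one w, ← h]
  exact funext fun j => congrFun hvw (Fin.castLE (by decide) j)

theorem finrank_C8 : Module.finrank (ZMod 3) C8 = 4 := by
  have h := LinearMap.finrank_range_of_inj (f := G8.vecMulLinear) vecMul_G8_injective
  rw [← rowCode_eq_range] at h
  exact h.trans (by simp)

theorem hasMinWeight_C8 : HasMinWeight C8 3 := by
  constructor
  · exact ⟨G8 0, Submodule.subset_span ⟨0, rfl⟩, by decide, by decide⟩
  · rintro _ ⟨x, hx, hx0, rfl⟩
    obtain ⟨v, rfl⟩ := mem_rowCode.1 hx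
    have key : ∀ v : Fin 4 → ZMod 3, v ≠ 0 → 3 ≤ hammingNorm (v ᵥ* G8) := by decide +kernel
    refine key v ?_
    rintro rfl
    exact hx0 (Matrix.zero_vecMul _)

theorem vecMul_projector8_mem (x : Fin 8 → ZMod 3) : x ᵥ* projector8 ∈ C8 := by
  rw [← projector8_eq_mul, ← Matrix.vecMul_vecMul]
  exact mem_rowCode.2 ⟨_, rfl⟩

theorem vecMul_projector8_of_mem {x : Fin 8 → ZMod 3} (hx : x ∈ C8) : x ᵥ* projector8 = x := by
  obtain ⟨v, rfl⟩ := mem_rowCode.1 hx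
  rw [Matrix.vecMul_vecMul, G8_mul_projector8]

/-- If x lies in both codes then x = xE, so x · y = x · (yE) = 0 for every y by symmetry of E. -/
theorem isLCD_C8 : IsLCD C8 := by
  rw [IsLCD, eq_bot_iff]
  rintro x ⟨hx, hx'⟩
  rw [Submodule.mem_bot, ← vecMul_projector8_of_mem hx]
  refine dotProduct_eq_zero _ fun y => ?_
  rw [← Matrix.dotProduct_mulVec, ← Matrix.vecMul_transpose, projector8_transpose]
  exact hx' _ (vecMul_projector8_mem y)

theorem projector8_mul_mul {P : Matrix (Fin 8) (Fin 8) (ZMod 3)} (h : ∀ x ∈ C8, x ᵥ* P ∈ C8) :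
    projector8 * P * projector8 = projector8 * P := by
  refine Matrix.ext_of_single_vecMul fun i => ?_
  rw [← Matrix.vecMul_vecMul]
  refine vecMul_projector8_of_mem ?_
  rw [← Matrix.vecMul_vecMul]
  exact h _ (vecMul_projector8_mem _)

/-- Both P and its transpose preserve the code, so EPE = EP and, after transposing, EPE = PE. -/
theorem projector8_mul_comm {P : GL (Fin 8) (ZMod 3)} (hP : P ∈ Aut C8) :
    projector8 * (P : Matrix (Fin 8) (Fin 8) (ZMod 3)) = P * projector8 := by
  have h1 := projector8_mul_mul fun x hx => vecMul_mem_of_eq_mulRight hP.2 hx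
  have h2 := projector8_mul_mul fun x hx => vecMul_transpose_mem_of_mem_Aut hP hx
  have h3 := congrArg Matrix.transpose h2
  simp only [Matrix.transpose_mul, Matrix.transpose_transpose, projector8_transpose] at h3
  rw [← h1, Matrix.mul_assoc, h3]

/-- The number of nonzero entries of row `i` in the columns with diagonal entry `d`. -/
def supportCount (A : Matrix (Fin 8) (Fin 8) (ZMod 3)) (i : Fin 8) (d : ZMod 3) : ℕ :=
  (Finset.univ.filter fun j => A i j ≠ 0 ∧ A j j = d).card

theorem supportCount_comp {A : Matrix (Fin 8) (Fin 8) (ZMod 3)} {σ : Fin 8 → Fin 8}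
    (hσ : σ.Bijective) (h0 : ∀ i j, A (σ i) (σ j) = 0 ↔ A i j = 0)
    (hd : ∀ i, A (σ i) (σ i) = A i i) (i : Fin 8) (d : ZMod 3) :
    supportCount A (σ i) d = supportCount A i d := by
  refine (Finset.card_bij (fun j _ => σ j) ?_ (fun _ _ _ _ h => hσ.1 h) ?_).symm
  · intro j
    simp [h0, hd]
  · intro k
    obtain ⟨j, rfl⟩ := hσ.2 k
    simpa [h0, hd] using fun h h' => ⟨j, ⟨h, h'⟩, rfl⟩

/-- The counts are invariant under any signed permutation commuting with the projector, and they
separate all eight rows. -/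
theorem projector8_rigid {i j : Fin 8} (h : ∀ d, supportCount projector8 i d =
    supportCount projector8 j d) : i = j := by
  revert i j
  decide +kernel

theorem eq_one_or_eq_neg_one_of_mem_Aut_C8 {P : GL (Fin 8) (ZMod 3)} (hP : P ∈ Aut C8) :
    P = 1 ∨ P = -1 := by
  obtain ⟨σ, ε, hσ, hε, hPe⟩ := hP.1.exists_eq_signedPerm
  have key : ∀ i j, projector8 (σ i) (σ j) * ε j = ε i * projector8 i j := by
    intro i j
    rw [← mul_signedPerm_apply, ← signedPerm_mul_apply hσ, ← hPe, projector8_mul_comm hP]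
  have hσ1 : ∀ i, σ i = i := by
    refine fun i => projector8_rigid fun d => supportCount_comp
      (Finite.injective_iff_bijective.1 hσ) (fun i j => ?_) (fun i => ?_) i d
    · simpa [hε] using congrArg (· = 0) (key i j)
    · exact mul_right_cancel₀ (hε i) ((key i i).trans (mul_comm _ _))
  simp only [hσ1] at key
  have hconn : ∀ {i j}, projector8 i j ≠ 0 → ε j = ε i := fun {i j} h =>
    mul_left_cancel₀ h ((key i j).trans (mul_comm _ _))
  -- The supports of rows 0 and 2 together cover all columns, and the entry at (2, 0) is nonzero, so
  -- the support graph is connected.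
  have hε2 : ∀ j, ε j = ε 0 := by
    intro j
    by_cases h : projector8 2 j = 0
    · have hj : projector8 0 j ≠ 0 := by
        revert j
        decide +kernel
      exact hconn hj
    · exact (hconn h).trans (hconn (by decide)).symm
  have hε0 : ε 0 = 1 ∨ ε 0 = -1 := by
    have : ∀ a : ZMod 3, a ≠ 0 → a = 1 ∨ a = -1 := by decide
    exact this _ (hε 0)
  refine hε0.imp (fun h => Units.ext ?_) (fun h => Units.ext ?_) <;>
  · ext i j
    by_cases hij : i = j <;> simp [hPe, signedPerm_apply, hσ1, hε2, h, hij]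

theorem card_Aut_C8 : Nat.card (Aut C8) = 2 := by
  refine (Nat.card_eq_two_iff' (1 : Aut C8)).2 ⟨⟨-1, neg_one_mem_Aut C8⟩, ?_, ?_⟩
  · exact fun h => one_ne_neg_one (by decide) (congrArg Subtype.val h).symm
  · rintro ⟨P, hP⟩ h
    refine Subtype.ext ((eq_one_or_eq_neg_one_of_mem_Aut_C8 hP).resolve_left fun h1 => h ?_)
    exact Subtype.ext h1

end C8

end LCDCode

theorem mainTheorem4 :
    (∀ (n : ℕ) (C : LCDCode.Code (ZMod 3) n), 1 ≤ n → LCDCode.IsLCD C →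
      2 ≤ Nat.card (LCDCode.Aut C)) ∧
    IsLeast {n : ℕ | ∃ C : LCDCode.Code (ZMod 3) n,
      1 ≤ Module.finrank (ZMod 3) C ∧ Module.finrank (ZMod 3) C < n ∧
      LCDCode.IsLCD C ∧ Nat.card (LCDCode.Aut C) = 2} 8 ∧
    (Module.finrank (ZMod 3) LCDCode.C8 = 4 ∧ LCDCode.HasMinWeight LCDCode.C8 3 ∧
      LCDCode.IsLCD LCDCode.C8 ∧ Nat.card (LCDCode.Aut LCDCode.C8) = 2) := by
  refine ⟨fun n C hn _ => LCDCode.two_le_card_Aut C hn, ⟨?_, ?_⟩,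
    LCDCode.finrank_C8, LCDCode.hasMinWeight_C8, LCDCode.isLCD_C8, LCDCode.card_Aut_C8⟩
  · refine ⟨LCDCode.C8, ?_, ?_, LCDCode.isLCD_C8, LCDCode.card_Aut_C8⟩ <;>
      rw [LCDCode.finrank_C8] <;> decide
  · rintro n ⟨C, h1, h2, -, h⟩
    by_contra! hn
    exact LCDCode.card_Aut_ne_two_of_lt_eight hn h1 h2 h
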